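/- Let the state $\omega\in\Omega=[0,1]$ have a distribution $F$ with a density $f\ge 0$, and let the type $\theta\in\Theta=\{1,\dots,n\}$ be independent of $\omega$ with $\Pr[\theta]=g(\theta)>0$, $\sum_\theta g(\theta)=1$. Let $A$ be a nonempty compact space of actions, and let the receiver's utility $u$ and the designer's utility $v$ on $A\times\Omega\times\Theta$ be of the form $u(a,\omega,\theta)=u_1(a,\theta)\,\omega+u_2(a,\theta)$ and $v(a,\omega,\theta)=v_1(a,\theta)\,\omega+v_2(a,\theta)$ with $u_1,u_2,v_1,v_2$ continuous in $a$. A signal $\mu$ is a Markov kernel $\mu(\cdot\mid\omega)$ from $\Omega$ to a measurable space $S$ of messages; $\mathbb E_\mu[\,\cdot\mid s]$ denotes expectation under the posterior distribution of the state given the message $s$. A mechanism $M$ is a set of signals. A strategy of the receiver in $M$ consists of signals $\mu^\theta\in M$ and actions $a^\theta(s)$, such that $s\mapsto\mathbb E_{\mu^\theta}[v(a^\theta(s),\omega,\theta)\mid s]$ is integrable; it is optimal in $M$ if, for every $\theta$, $a^\theta(s)\in\arg\max_{b\in A}\mathbb E_{\mu^\theta}[u(b,\omega,\theta)\mid s]$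 for almost every message $s$ of $\mu^\theta$, and $$\mu^\theta\in\arg\max_{\nu\in M}\int_\Omega\int_S\max_{b\in A}\mathbb E_\nu[u(b,\omega,\theta)\mid s]\,d\nu(s\mid\omega)\,dF(\omega).$$ The designer's payoff is then $$\sum_{\theta\in\Theta}g(\theta)\int_\Omega\int_S\mathbb E_{\mu^\theta}[v(a^\theta(s),\omega,\theta)\mid s]\,d\mu^\theta(s\mid\omega)\,dF(\omega).$$ Put $\bar u(m,\theta)=\max_{a\in A}u(a,m,\theta)$, $A(m,\theta)=\arg\max_{b\in A}u(b,m,\theta)$ and $\bar v(m,\theta)=\max_{a\in A(m,\theta)}v(a,m,\theta)$. A direct mechanism is a tuple $(\mu^1,\dots,\mu^n)$ of signals; let $G_\theta(x)=\Pr[\mathbb E_{\mu^\theta}[\omega\mid s]\le x]$ be the distribution of the posterior mean induced by $\mu^\theta$. It is incentive compatible if $\int_\Omega\bar u(s,\theta)\,dG_\theta(s)\ge\int_\Omega\bar u(s,\theta)\,dG_{\theta'}(s)$ for all $\theta,\theta'\in\Theta$. It maximizes the designer's payoff if there are actions $a$ such that the strategy in which each type $\theta$ chooses $\mu^\theta$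 and acts according to $a^\theta$ is optimal for the receiver in $\{\mu^1,\dots,\mu^n\}$ and gives the designer at least the payoff of any mechanism $M$ with any optimal strategy of the receiver in $M$. Then the direct mechanism $(\mu^1,\dots,\mu^n)$ is incentive compatible and maximizes the designer's payoff if and only if the induced $(G_1,\dots,G_n)$ solves $$\max_{H_1,\dots,H_n}\ \sum_{\theta\in\Theta}g(\theta)\int_\Omega\bar v(s,\theta)\,dH_\theta(s)$$ over all tuples of probability distributions on $[0,1]$ such that $$\int_0^1\bar u(s,\theta)\,dH_\theta(s)\ \ge\ \int_0^1\bar u(s,\theta)\,dH_{\theta'}(s)\qquad\forall\,\theta,\theta'\in\Theta,$$ and every $H_\theta$ is a mean-preserving contraction of $F$, that is, in terms of cumulative distribution functions, $\int_x^1H_\theta(z)\,dz\ge\int_x^1F(z)\,dz$ for all $x\in[0,1]$, with equality for $x=0$. -/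

import Mathlib

open MeasureTheory ProbabilityTheory

universe u w

noncomputable section

namespace InfoDesign

/-- The state space `Ω = [0, 1]`. -/
abbrev State : Type := unitInterval

/-! ### Signals (Blackwell experiments) -/

/-- A signal: a measurable space `S` of messages and, for every state `ω`, a conditional
distribution `μ(· | ω)` on `S`, measurable in `ω`. -/
structure Signal : Type (u + 1) where
  /-- the set of signal realizations (messages) -/
  S : Type u
  [measurableSpace : MeasurableSpace S]
  /-- the conditional distributions `μ(· | ω)` -/
  kernel : Kernel State S
  [isMarkov : IsMarkovKernel kernel]

attribute [instance] Signal.measurableSpace Signal.isMarkov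

variable (F : Measure State) [IsProbabilityMeasure F]

/-- The unconditional distribution of the message of the signal `μ`. -/
def Signal.messageLaw (μ : Signal.{u}) : Measure μ.S := F.bind μ.kernel

/-- The posterior distribution of the state given the message `s`: a regular conditional
probability of the state given the message (unique up to null sets of messages). -/
def Signal.posterior (μ : Signal.{u}) : Kernel μ.S State := ProbabilityTheory.posterior μ.kernel F

instance (μ : Signal.{u}) : IsMarkovKernel (μ.posterior F) := by
  unfold Signal.posterior; infer_instance

instance (μ : Signal.{u}) : IsProbabilityMeasure (μ.messageLaw F) := by
  unfold Signal.messageLaw; infer_instance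

/-- The mean of a distribution on `[0, 1]` lies in `[0, 1]`. -/
theorem mean_mem (P : Measure State) [IsProbabilityMeasure P] :
    (∫ ω, (ω : ℝ) ∂P) ∈ Set.Icc (0 : ℝ) 1 := by
  refine ⟨integral_nonneg fun ω => ω.2.1, ?_⟩
  have h : Integrable (fun ω : State => (ω : ℝ)) P :=
    Integrable.of_bound (by fun_prop) 1
      (Filter.Eventually.of_forall fun ω => by
        rw [Real.norm_eq_abs, abs_of_nonneg ω.2.1]; exact ω.2.2)
  calc (∫ ω, (ω : ℝ) ∂P) ≤ ∫ _, (1 : ℝ) ∂P :=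
        integral_mono h (integrable_const _) fun ω => ω.2.2
    _ = 1 := by simp

/-- The posterior mean `E_μ[ω | s]`, a point of `[0, 1]`. -/
def Signal.posteriorMean (μ : Signal.{u}) (s : μ.S) : State :=
  ⟨∫ ω, (ω : ℝ) ∂(μ.posterior F s), mean_mem _⟩

theorem Signal.measurable_posteriorMean (μ : Signal.{u}) : Measurable (μ.posteriorMean F) := by
  refine Measurable.subtype_mk ?_
  have h : StronglyMeasurable fun ω : State => (ω : ℝ) :=
    (measurable_subtype_coe).stronglyMeasurable
  exact (h.integral_kernel (κ := μ.posterior F)).measurable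

/-- The distribution `G` of the posterior mean induced by the signal `μ`, i.e. the distribution
with CDF `G(x) = Pr[E_μ[ω | s] ≤ x]`. -/
def Signal.meanLaw (μ : Signal.{u}) : ProbabilityMeasure State :=
  ⟨(μ.messageLaw F).map (μ.posteriorMean F),
    Measure.isProbabilityMeasure_map (μ.measurable_posteriorMean F).aemeasurable⟩

/-! ### Mean-preserving contractions -/

/-- The cumulative distribution function of a distribution on `[0, 1]`. -/
def cdfState (H : Measure State) (z : ℝ) : ℝ := H.real {ω : State | (ω : ℝ) ≤ z}

/-- `H` is a mean-preserving contraction of `H'` (written `H' ⪯ H`). -/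
def IsMPC (H' H : Measure State) : Prop :=
  (∀ ω : State, ∫ z in (ω : ℝ)..1, cdfState H z ≥ ∫ z in (ω : ℝ)..1, cdfState H' z) ∧
    ∫ z in (0 : ℝ)..1, cdfState H z = ∫ z in (0 : ℝ)..1, cdfState H' z

/-! ### Utilities -/

variable {A : Type w} {n : ℕ}

/-- Quasi-linearity in the state, with coefficients continuous in the action. -/
def QuasiLinear [TopologicalSpace A] (U : A → State → Fin n → ℝ) : Prop :=
  ∃ U₁ U₂ : A → Fin n → ℝ, (∀ θ, Continuous fun a => U₁ a θ) ∧ (∀ θ, Continuous fun a => U₂ a θ) ∧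
    ∀ a ω θ, U a ω θ = U₁ a θ * (ω : ℝ) + U₂ a θ

/-- The receiver's indirect utility `ū(m, θ) = max_{a ∈ A} u(a, m, θ)`. -/
def receiverIndirect (u : A → State → Fin n → ℝ) (m : State) (θ : Fin n) : ℝ := ⨆ a, u a m θ

/-- The set of optimal actions `A(m, θ) = argmax_{b ∈ A} u(b, m, θ)`. -/
def optimalActions (u : A → State → Fin n → ℝ) (m : State) (θ : Fin n) : Set A :=
  {a | ∀ b, u b m θ ≤ u a m θ}

/-- The designer's indirect utility `v̄(m, θ) = max_{a ∈ A(m, θ)} v(a, m, θ)`. -/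
def designerIndirect (u v : A → State → Fin n → ℝ) (m : State) (θ : Fin n) : ℝ :=
  sSup ((fun a => v a m θ) '' optimalActions u m θ)

/-! ### Mechanisms and strategies -/

/-- The conditional expectation `E_μ[U(b, ω, θ) | s]`, given the message `s` of `μ`. -/
def Signal.condExpUtility (U : A → State → Fin n → ℝ) (μ : Signal.{u}) (s : μ.S) (b : A)
    (θ : Fin n) : ℝ :=
  ∫ ω, U b ω θ ∂(μ.posterior F s)

/-- The expected utility of type `θ` from observing the signal `ν` and then acting optimally. -/
def Signal.receiverValue (u : A → State → Fin n → ℝ) (ν : Signal.{u}) (θ : Fin n) : ℝ :=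
  ∫ ω, ∫ s, (⨆ b, ν.condExpUtility F u s b θ) ∂(ν.kernel ω) ∂F

/-- A strategy of the receiver: the signal `μ^θ` chosen by type `θ` and the action `a^θ(s)` that
type `θ` takes after the message `s`. -/
structure Strategy (A : Type w) (n : ℕ) where
  /-- the chosen signals -/
  signal : Fin n → Signal.{u}
  /-- the chosen actions -/
  action : (θ : Fin n) → (signal θ).S → A

/-- `σ` is an optimal strategy of the receiver in the mechanism (menu of signals) `M`. -/
structure Strategy.IsOptimal (u : A → State → Fin n → ℝ) (M : Set Signal.{u})
    (σ : Strategy.{u} A n) : Prop where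
  /-- every type chooses a signal of the menu -/
  mem : ∀ θ, σ.signal θ ∈ M
  /-- actions are optimal after almost every message -/
  optAct : ∀ θ, ∀ᵐ s ∂((σ.signal θ).messageLaw F), ∀ b,
    (σ.signal θ).condExpUtility F u s b θ ≤ (σ.signal θ).condExpUtility F u s (σ.action θ s) θ
  /-- every type chooses a signal that is best for him in the menu -/
  optSignal : ∀ θ, ∀ ν ∈ M, ν.receiverValue F u θ ≤ (σ.signal θ).receiverValue F u θ

/-- The designer's expected utility under `σ` exists: for every type, her conditional expected
utility given the message is integrable. This is the only measurability asked of the actions. -/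
def Strategy.HasPayoff (v : A → State → Fin n → ℝ) (σ : Strategy.{u} A n) : Prop :=
  ∀ θ, Integrable (fun s => (σ.signal θ).condExpUtility F v s (σ.action θ s) θ)
    ((σ.signal θ).messageLaw F)

/-- The designer's expected utility under the strategy `σ` of the receiver. -/
def Strategy.designerPayoff (g : Fin n → ℝ) (v : A → State → Fin n → ℝ)
    (σ : Strategy.{u} A n) : ℝ :=
  ∑ θ, g θ * ∫ ω, ∫ s, (σ.signal θ).condExpUtility F v s (σ.action θ s) θ
    ∂((σ.signal θ).kernel ω) ∂F

/-- Incentive compatibility of the direct mechanism `(μ^1, …, μ^n)`. -/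
def IncentiveCompatible (u : A → State → Fin n → ℝ) (μ : Fin n → Signal.{u}) : Prop :=
  ∀ θ θ', ∫ s, receiverIndirect u s θ ∂((μ θ).meanLaw F : Measure State) ≥
    ∫ s, receiverIndirect u s θ ∂((μ θ').meanLaw F : Measure State)

/-- The direct mechanism `(μ^1, …, μ^n)` maximizes the designer's payoff: together with some
optimal strategy of the receiver in which every type `θ` chooses `μ^θ`, it gives the designer at
least as much as every mechanism `M` with every optimal strategy of the receiver in `M`. -/
def DesignerOptimal (g : Fin n → ℝ) (u v : A → State → Fin n → ℝ)
    (μ : Fin n → Signal.{u}) : Prop :=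
  ∃ a : (θ : Fin n) → (μ θ).S → A,
    (Strategy.mk μ a).IsOptimal F u (Set.range μ) ∧ (Strategy.mk μ a).HasPayoff F v ∧
    ∀ (M : Set Signal.{u}) (σ : Strategy.{u} A n), σ.IsOptimal F u M → σ.HasPayoff F v →
      σ.designerPayoff F g v ≤ (Strategy.mk μ a).designerPayoff F g v

/-! ### The program over posterior-mean distributions -/

/-- The constraints of the program. -/
structure ProgramFeasible (u : A → State → Fin n → ℝ)
    (G : Fin n → ProbabilityMeasure State) : Prop where
  /-- the incentive constraints -/
  ic : ∀ θ θ', ∫ s, receiverIndirect u s θ ∂(G θ : Measure State) ≥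
    ∫ s, receiverIndirect u s θ ∂(G θ' : Measure State)
  /-- every `G θ` is a mean-preserving contraction of `F` -/
  mpc : ∀ θ, IsMPC F (G θ : Measure State)

/-- The objective of the program. -/
def programObjective (g : Fin n → ℝ) (u v : A → State → Fin n → ℝ)
    (G : Fin n → ProbabilityMeasure State) : ℝ :=
  ∑ θ, g θ * ∫ s, designerIndirect u v s θ ∂(G θ : Measure State)

/-- `(G_1, …, G_n)` solves the program. -/
def SolvesProgram (g : Fin n → ℝ) (u v : A → State → Fin n → ℝ)
    (G : Fin n → ProbabilityMeasure State) : Prop :=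
  ProgramFeasible F u G ∧
    ∀ H : Fin n → ProbabilityMeasure State, ProgramFeasible F u H →
      programObjective g u v H ≤ programObjective g u v G

end InfoDesign

end

/-
Affine utilities make every conditional expected utility a function of the posterior mean alone.
Hence an optimal strategy is worth at most the program's objective at the laws of the posterior
mean it induces, with equality when the receiver breaks ties in the designer's favour. It remains
to know which laws of posterior means arise. By Jensen's inequality they are mean-preserving
contractions of the prior `F`. Conversely, if `H` is one, then `∫ c ∂F ≤ ∫ c ∂H` for every Lipschitz
concave `c`, since such a `c` is an affine function plus a positive mixture of the hinges
`y ↦ min y τ`. This is what the Riesz extension and representation theorems need to provide a joint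
law of state and message with marginals `F` and `H` under which the message is the posterior mean.
-/

namespace InfoDesign

section Integration

theorem integrable_of_continuous {X : Type*} [TopologicalSpace X] [CompactSpace X]
    [MeasurableSpace X] [OpensMeasurableSpace X] (P : Measure X) [IsFiniteMeasureOnCompacts P]
    {φ : X → ℝ} (hφ : Continuous φ) : Integrable φ P :=
  hφ.integrable_of_hasCompactSupport (HasCompactSupport.of_compactSpace φ)

theorem integral_bind_kernel {α β : Type*} [MeasurableSpace α] [MeasurableSpace β]
    {P : Measure α} {κ : Kernel α β} {φ : β → ℝ} (hφ : Integrable φ (P.bind κ)) :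
    ∫ y, φ y ∂(P.bind κ) = ∫ x, ∫ y, φ y ∂(κ x) ∂P := by
  rw [Measure.comp_eq_comp_const_apply] at hφ ⊢
  rw [Kernel.integral_comp hφ, Kernel.const_apply]

theorem integrable_integral_bind_kernel {α β : Type*} [MeasurableSpace α] [MeasurableSpace β]
    {P : Measure α} {κ : Kernel α β} {φ : β → ℝ} (hφ : Integrable φ (P.bind κ)) :
    Integrable (fun x => ∫ y, φ y ∂(κ x)) P := by
  rw [Measure.comp_eq_comp_const_apply] at hφ
  simpa only [Kernel.const_apply] using hφ.integral_comp

end Integration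

section ConcaveFunctions

theorem le_apply_min_of_isMaxOn {c : ℝ → ℝ} {s : Set ℝ} (hc : ConcaveOn ℝ s c) {τ : ℝ}
    (hτs : τ ∈ s) (hτ : IsMaxOn c s τ) {y z : ℝ} (hz : z ∈ s) (hzy : z ≤ y) :
    c z ≤ c (min y τ) := by
  rcases le_total y τ with hyτ | hτy
  · rw [min_eq_left hyτ]
    simpa only [min_eq_left (show c z ≤ c τ from hτ hz)] using
      hc.min_le_of_mem_Icc hz hτs ⟨hzy, hyτ⟩
  · rw [min_eq_right hτy]
    exact hτ hz

theorem exists_isMaxOn_tilt {c : ℝ → ℝ} (hc : ConcaveOn ℝ (Set.Icc 0 1) c)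
    (hcont : ContinuousOn c (Set.Icc 0 1)) (l : ℝ) :
    ∃ τ : State, ∀ y z : State, z ≤ y →
      c z - l * z ≤ c (min (y : ℝ) τ) - l * min (y : ℝ) τ := by
  have htilt : ConcaveOn ℝ (Set.Icc 0 1) fun x => c x - l * x :=
    hc.sub ((LinearMap.mul ℝ ℝ l).convexOn (convex_Icc 0 1))
  obtain ⟨τ, hτ, hmax⟩ := isCompact_Icc.exists_isMaxOn (Set.nonempty_Icc.2 zero_le_one)
    (hcont.sub (by fun_prop : ContinuousOn (fun x => l * x) (Set.Icc 0 1)))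
  exact ⟨⟨τ, hτ⟩, fun y z hzy => le_apply_min_of_isMaxOn htilt hτ hmax z.2 hzy⟩

theorem monotoneOn_add_mul_of_lipschitzOnWith {c : ℝ → ℝ} {s : Set ℝ} {K : NNReal}
    (hK : LipschitzOnWith K c s) : MonotoneOn (fun x => c x + K * x) s := by
  intro x hx y hy hxy
  have := hK.le_add_mul hx hy
  rw [Real.dist_eq, abs_of_nonpos (sub_nonpos.2 hxy)] at this
  linarith

theorem antitoneOn_sub_mul_of_lipschitzOnWith {c : ℝ → ℝ} {s : Set ℝ} {K : NNReal}
    (hK : LipschitzOnWith K c s) : AntitoneOn (fun x => c x - K * x) s := by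
  intro x hx y hy hxy
  have := hK.le_add_mul hy hx
  rw [Real.dist_eq, abs_of_nonneg (sub_nonneg.2 hxy)] at this
  linarith

/- A concave function is an affine function plus a mixture of the hinges `y ↦ min y τ`, where `τ`
maximizes `c y - l * y` and the tilt `l` is spread evenly over the range `[-K, K]` of slopes: the
derivative in `l` of `max_{z ≤ y} (c z - l * z)` is `-min y τ`. -/
theorem exists_hinge_bounds {c : ℝ → ℝ} {K : NNReal} (hc : ConcaveOn ℝ (Set.Icc 0 1) c)
    (hK : LipschitzOnWith K c (Set.Icc 0 1)) {N : ℕ} (hN : N ≠ 0) :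
    ∃ τ : ℕ → State, ∀ y : State,
      2 * K / N * ∑ k ∈ Finset.range N, min (y : ℝ) (τ (k + 1)) ≤ c y - c 0 + K * y ∧
        c y - c 0 + K * y ≤ 2 * K / N * ∑ k ∈ Finset.range N, min (y : ℝ) (τ k) := by
  let l : ℕ → ℝ := fun k => -K + k * (2 * K / N)
  have hl_succ (k : ℕ) : l (k + 1) = l k + 2 * K / N := by simp only [l]; push_cast; ring
  have hl_zero : l 0 = -K := by simp [l]
  have hl_last : l N = K := by simp only [l]; field_simp; ring
  choose τ hτ using fun k => exists_isMaxOn_tilt hc hK.continuousOn (l k)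
  refine ⟨τ, fun y => ?_⟩
  let M : ℕ → ℝ := fun k => c (min (y : ℝ) (τ k)) - l k * min (y : ℝ) (τ k)
  have hstep (j k : ℕ) : c (min (y : ℝ) (τ j)) - l k * min (y : ℝ) (τ j) ≤ M k := by
    simpa using hτ k y (min y (τ j)) (min_le_left _ _)
  have hM_zero : M 0 = c y + K * y := by
    refine le_antisymm ?_ ?_
    · simpa [M, hl_zero] using monotoneOn_add_mul_of_lipschitzOnWith hK (min y (τ 0)).2 y.2
        (min_le_left (y : ℝ) (τ 0))
    · simpa [M, hl_zero] using hτ 0 y y le_rfl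
  have hM_last : M N = c 0 := by
    refine le_antisymm ?_ ?_
    · simpa [M, hl_last] using antitoneOn_sub_mul_of_lipschitzOnWith hK (0 : State).2
        (min y (τ N)).2 (min y (τ N)).2.1
    · simpa [M, hl_last] using hτ N y 0 y.2.1
  have htelescope : c y - c 0 + K * y = ∑ k ∈ Finset.range N, (M k - M (k + 1)) := by
    rw [Finset.sum_range_sub', hM_zero, hM_last]
    ring
  rw [htelescope, Finset.mul_sum, Finset.mul_sum]
  constructor <;> refine Finset.sum_le_sum fun k _ => ?_
  · have := hstep (k + 1) k
    simp only [M, hl_succ] at this ⊢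
    linarith
  · have := hstep k (k + 1)
    simp only [M, hl_succ] at this ⊢
    linarith

theorem exists_hinge_approx {c : ℝ → ℝ} {K : NNReal} (hc : ConcaveOn ℝ (Set.Icc 0 1) c)
    (hK : LipschitzOnWith K c (Set.Icc 0 1)) {ε : ℝ} (hε : 0 < ε) :
    ∃ (a b r : ℝ) (N : ℕ) (τ : ℕ → State), 0 ≤ r ∧ ∀ y : State,
      c y ≤ a + b * y + r * ∑ k ∈ Finset.range N, min (y : ℝ) (τ k) ∧
        a + b * y + r * ∑ k ∈ Finset.range N, min (y : ℝ) (τ k) ≤ c y + ε := by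
  obtain ⟨N, hN⟩ := exists_nat_gt (2 * K / ε)
  have hN_pos : (0 : ℝ) < N := lt_of_le_of_lt (by positivity) hN
  have hr : 2 * K / N ≤ ε := ((div_lt_comm₀ hε hN_pos).1 hN).le
  obtain ⟨τ, hτ⟩ := exists_hinge_bounds hc hK (Nat.cast_pos.1 hN_pos).ne'
  refine ⟨c 0, -K, 2 * K / N, N, τ, by positivity, fun y => ⟨by linarith [(hτ y).2], ?_⟩⟩
  have hgap : ∑ k ∈ Finset.range N, min (y : ℝ) (τ k) -
      ∑ k ∈ Finset.range N, min (y : ℝ) (τ (k + 1)) ≤ 1 := by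
    rw [← Finset.sum_sub_distrib, Finset.sum_range_sub' (fun k => min (y : ℝ) (τ k))]
    linarith [min_le_left (y : ℝ) (τ 0), y.2.2, le_min y.2.1 (τ N).2.1]
  have := mul_le_mul_of_nonneg_left hgap (by positivity : 0 ≤ 2 * (K : ℝ) / N)
  linarith [(hτ y).1]

theorem concaveOn_ciInf {ι : Type*} [Nonempty ι] {E : Type*} [AddCommMonoid E] [SMul ℝ E]
    {s : Set E} {f : ι → E → ℝ} (hf : ∀ i, ConcaveOn ℝ s (f i))
    (hbdd : ∀ x ∈ s, BddBelow (Set.range fun i => f i x)) :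
    ConcaveOn ℝ s fun x => ⨅ i, f i x := by
  refine ⟨(hf (Classical.arbitrary ι)).1, fun x hx y hy a b ha hb hab => le_ciInf fun i => ?_⟩
  exact (add_le_add (mul_le_mul_of_nonneg_left (ciInf_le (hbdd x hx) i) ha)
    (mul_le_mul_of_nonneg_left (ciInf_le (hbdd y hy) i) hb)).trans ((hf i).2 hx hy ha hb hab)

theorem lipschitzWith_ciInf {ι : Type*} [Nonempty ι] {E : Type*} [PseudoMetricSpace E]
    {K : NNReal} {f : ι → E → ℝ} (hf : ∀ i, LipschitzWith K (f i))
    (hbdd : ∀ x, BddBelow (Set.range fun i => f i x)) :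
    LipschitzWith K fun x => ⨅ i, f i x := by
  refine LipschitzWith.of_le_add_mul K fun x y => ?_
  rw [← sub_le_iff_le_add]
  refine le_ciInf fun i => ?_
  linarith [ciInf_le (hbdd x) i, (hf i).le_add_mul x y]

end ConcaveFunctions

section MeanPreservingContraction

theorem integral_cdfState (H : Measure State) [IsProbabilityMeasure H] (x : State) :
    ∫ z in (x : ℝ)..1, cdfState H z =
      1 - x - ∫ ω : State, (ω : ℝ) ∂H + ∫ ω : State, min (ω : ℝ) x ∂H := by
  have hlevel (t : ℝ) (ht : t ≤ 1 - x) :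
      H.real {ω : State | t ≤ 1 - max (ω : ℝ) x} = cdfState H (1 - t) := by
    rw [cdfState]
    congr 1
    ext ω
    simp only [Set.mem_ofPred_eq, le_sub_comm (a := t), max_le_iff, le_sub_comm.1 ht, and_true]
  have hmax : ∫ ω : State, (1 - max (ω : ℝ) x) ∂H =
      1 - x - ∫ ω : State, (ω : ℝ) ∂H + ∫ ω : State, min (ω : ℝ) x ∂H := by
    have hrw (ω : State) : 1 - max (ω : ℝ) x = (1 - x) - ω + min (ω : ℝ) x := by
      linarith [min_add_max (ω : ℝ) x]
    simp only [hrw]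
    rw [integral_add (integrable_of_continuous H (by fun_prop))
      (integrable_of_continuous H (by fun_prop)), integral_sub (integrable_const _)
      (integrable_of_continuous H (by fun_prop))]
    simp
  calc ∫ z in (x : ℝ)..1, cdfState H z
    _ = ∫ t in (0 : ℝ)..1 - x, cdfState H (1 - t) := by
      rw [intervalIntegral.integral_comp_sub_left (cdfState H)]
      simp
    _ = ∫ t in Set.Ioc (0 : ℝ) (1 - x), H.real {ω : State | t ≤ 1 - max (ω : ℝ) x} := by
      rw [intervalIntegral.integral_of_le (sub_nonneg.2 x.2.2)]
      exact setIntegral_congr_fun measurableSet_Ioc fun t ht => (hlevel t ht.2).symm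
    _ = ∫ ω : State, (1 - max (ω : ℝ) x) ∂H :=
      (Integrable.integral_eq_integral_Ioc_meas_le
        (integrable_of_continuous H (by fun_prop))
        (Filter.Eventually.of_forall fun ω => sub_nonneg.2 (max_le ω.2.2 x.2.2))
        (Filter.Eventually.of_forall fun ω => sub_le_sub_left (le_max_right _ _) _)).symm
    _ = _ := hmax

theorem isMPC_iff {F H : Measure State} [IsProbabilityMeasure F] [IsProbabilityMeasure H] :
    IsMPC F H ↔
      (∀ x : State, ∫ ω : State, min (ω : ℝ) x ∂F ≤ ∫ ω : State, min (ω : ℝ) x ∂H) ∧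
        ∫ ω : State, (ω : ℝ) ∂H = ∫ ω : State, (ω : ℝ) ∂F := by
  have hzero (P : Measure State) [IsProbabilityMeasure P] :
      ∫ z in (0 : ℝ)..1, cdfState P z = 1 - ∫ ω : State, (ω : ℝ) ∂P := by
    simpa [min_eq_right (unitInterval.nonneg _)] using integral_cdfState P 0
  simp only [IsMPC, integral_cdfState, hzero, sub_right_inj]
  refine and_congr_left fun hmean => forall_congr' fun x => ?_
  rw [hmean, ge_iff_le, add_le_add_iff_left]

variable {F H : Measure State} [IsProbabilityMeasure F] [IsProbabilityMeasure H]

theorem IsMPC.integral_concaveOn_le (hFH : IsMPC F H) {c : ℝ → ℝ} {K : NNReal}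
    (hc : ConcaveOn ℝ (Set.Icc 0 1) c) (hK : LipschitzOnWith K c (Set.Icc 0 1)) :
    ∫ ω : State, c ω ∂F ≤ ∫ ω : State, c ω ∂H := by
  obtain ⟨hmin, hmean⟩ := isMPC_iff.1 hFH
  have hc_int (P : Measure State) [IsProbabilityMeasure P] :
      Integrable (fun ω : State => c ω) P :=
    integrable_of_continuous P (continuousOn_iff_continuous_domRestrict.1 hK.continuousOn)
  refine le_of_forall_pos_le_add fun ε hε => ?_
  obtain ⟨a, b, r, N, τ, hr, hτ⟩ := exists_hinge_approx hc hK hε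
  let p : State → ℝ := fun y => a + b * y + r * ∑ k ∈ Finset.range N, min (y : ℝ) (τ k)
  have hp_int (P : Measure State) [IsProbabilityMeasure P] : Integrable p P :=
    integrable_of_continuous P (by fun_prop)
  have hp (P : Measure State) [IsProbabilityMeasure P] : ∫ y, p y ∂P = a + b * ∫ y, (y : ℝ) ∂P +
      r * ∑ k ∈ Finset.range N, ∫ y : State, min (y : ℝ) (τ k) ∂P := by
    rw [← integral_finsetSum _ fun k _ => integrable_of_continuous P (by fun_prop),
      ← integral_const_mul, ← integral_const_mul,
      integral_add (integrable_of_continuous P (by fun_prop))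
        (integrable_of_continuous P (by fun_prop)),
      integral_add (integrable_const a) (integrable_of_continuous P (by fun_prop))]
    simp
  calc ∫ ω : State, c ω ∂F ≤ ∫ ω, p ω ∂F := integral_mono (hc_int F) (hp_int F) fun ω => (hτ ω).1
    _ ≤ ∫ ω, p ω ∂H := by
      rw [hp, hp, hmean]
      gcongr a + b * _ + r * ∑ k ∈ _, ?_ with k
      exact hmin (τ k)
    _ ≤ ∫ ω : State, (c ω + ε) ∂H :=
      integral_mono (hp_int H) ((hc_int H).add (integrable_const ε)) fun ω => (hτ ω).2
    _ = ∫ ω : State, c ω ∂H + ε := by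
      rw [integral_add (hc_int H) (integrable_const ε)]
      simp

end MeanPreservingContraction

section PosteriorMean

variable {F : Measure State} [IsProbabilityMeasure F]

theorem Signal.integral_meanLaw (μ : Signal.{u}) {φ : State → ℝ} (hφ : Measurable φ) :
    ∫ m, φ m ∂(μ.meanLaw F : Measure State) = ∫ s, φ (μ.posteriorMean F s) ∂(μ.messageLaw F) :=
  integral_map (μ.measurable_posteriorMean F).aemeasurable hφ.aestronglyMeasurable

theorem Signal.integral_integral_posterior (μ : Signal.{u}) {φ : State → ℝ}
    (hφ : Integrable φ F) :
    ∫ s, ∫ ω, φ ω ∂(μ.posterior F s) ∂(μ.messageLaw F) = ∫ ω, φ ω ∂F := by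
  have hbind : (μ.messageLaw F).bind (μ.posterior F) = F := posterior_comp_self
  rw [← integral_bind_kernel (by rwa [hbind]), hbind]

theorem Signal.integrable_integral_posterior (μ : Signal.{u}) {φ : State → ℝ}
    (hφ : Integrable φ F) :
    Integrable (fun s => ∫ ω, φ ω ∂(μ.posterior F s)) (μ.messageLaw F) := by
  have hbind : (μ.messageLaw F).bind (μ.posterior F) = F := posterior_comp_self
  exact integrable_integral_bind_kernel (by rwa [hbind])

theorem Signal.isMPC_meanLaw (μ : Signal.{u}) : IsMPC F (μ.meanLaw F : Measure State) := by
  refine isMPC_iff.2 ⟨fun x => ?_, ?_⟩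
  · have hc : Continuous fun ω : State => min (ω : ℝ) x := by fun_prop
    rw [μ.integral_meanLaw hc.measurable,
      ← μ.integral_integral_posterior (integrable_of_continuous F hc)]
    refine integral_mono (μ.integrable_integral_posterior (integrable_of_continuous F hc))
      ((integrable_of_continuous _ hc).comp_measurable (μ.measurable_posteriorMean F))
      fun s => le_min ?_ ?_
    · exact integral_mono (integrable_of_continuous _ hc)
        (integrable_of_continuous _ continuous_subtype_val) fun ω => min_le_left _ _
    · simpa using integral_mono (μ := μ.posterior F s) (integrable_of_continuous _ hc)
        (integrable_const (x : ℝ)) fun ω => min_le_right _ _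
  · rw [μ.integral_meanLaw measurable_subtype_coe,
      ← μ.integral_integral_posterior (integrable_of_continuous F continuous_subtype_val)]
    rfl

end PosteriorMean

section IndirectUtility

variable {A : Type w} [TopologicalSpace A] {n : ℕ} {u v : A → State → Fin n → ℝ} {θ : Fin n}

theorem QuasiLinear.continuous {U : A → State → Fin n → ℝ} (hU : QuasiLinear U) (θ : Fin n) :
    Continuous fun p : A × State => U p.1 p.2 θ := by
  obtain ⟨U₁, U₂, h₁, h₂, hU⟩ := hU
  have h₁θ := h₁ θ
  have h₂θ := h₂ θ
  simp only [hU]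
  fun_prop

variable [CompactSpace A]

theorem continuous_receiverIndirect (hu : Continuous fun p : A × State => u p.1 p.2 θ) :
    Continuous fun m => receiverIndirect u m θ := by
  simpa only [Set.image_univ, receiverIndirect, sSup_range] using
    isCompact_univ.continuous_sSup (f := fun (m : State) (a : A) => u a m θ) (K := Set.univ)
      (hu.comp continuous_swap)

theorem isCompact_optimalActions (hu : Continuous fun p : A × State => u p.1 p.2 θ)
    (m : State) : IsCompact (optimalActions u m θ) := by
  simp only [optimalActions, Set.ofPred_forall]
  exact (isClosed_iInter fun b => isClosed_le continuous_const
    (hu.comp (Continuous.prodMk_left m))).isCompact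

theorem le_designerIndirect (hv : Continuous fun p : A × State => v p.1 p.2 θ)
    {m : State} {a : A} (ha : a ∈ optimalActions u m θ) : v a m θ ≤ designerIndirect u v m θ :=
  le_csSup ((isCompact_range (hv.comp (Continuous.prodMk_left m))).bddAbove.mono
    (Set.image_subset_range _ _)) ⟨a, ha, rfl⟩

variable [Nonempty A]

theorem nonempty_optimalActions (hu : Continuous fun p : A × State => u p.1 p.2 θ)
    (m : State) : (optimalActions u m θ).Nonempty := by
  obtain ⟨a, -, ha⟩ := isCompact_univ.exists_isMaxOn Set.univ_nonempty
    (hu.comp (Continuous.prodMk_left m)).continuousOn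
  exact ⟨a, fun b => ha (Set.mem_univ b)⟩

theorem exists_eq_designerIndirect (hu : Continuous fun p : A × State => u p.1 p.2 θ)
    (hv : Continuous fun p : A × State => v p.1 p.2 θ) (m : State) :
    ∃ a ∈ optimalActions u m θ, v a m θ = designerIndirect u v m θ := by
  obtain ⟨a, ha, h⟩ := (isCompact_optimalActions hu m).exists_sSup_image_eq
    (nonempty_optimalActions hu m) (hv.comp (Continuous.prodMk_left m)).continuousOn
  exact ⟨a, ha, h.symm⟩

theorem upperSemicontinuous_designerIndirect (hu : Continuous fun p : A × State => u p.1 p.2 θ)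
    (hv : Continuous fun p : A × State => v p.1 p.2 θ) :
    UpperSemicontinuous fun m => designerIndirect u v m θ := by
  rw [upperSemicontinuous_iff_isClosed_preimage]
  intro c
  have hproj : (fun m => designerIndirect u v m θ) ⁻¹' Set.Ici c =
      Prod.snd '' {p : A × State | (∀ b, u b p.2 θ ≤ u p.1 p.2 θ) ∧ c ≤ v p.1 p.2 θ} := by
    ext m
    constructor
    · intro hm
      obtain ⟨a, ha, hav⟩ := exists_eq_designerIndirect hu hv m
      exact ⟨(a, m), ⟨ha, hav ▸ hm⟩, rfl⟩
    · rintro ⟨⟨a, m⟩, ⟨ha, hc⟩, rfl⟩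
      exact hc.trans (le_designerIndirect hv ha)
  rw [hproj]
  refine isClosedMap_snd_of_compactSpace _ (IsClosed.and ?_ (isClosed_le continuous_const hv))
  simp only [Set.ofPred_forall]
  exact isClosed_iInter fun b =>
    isClosed_le (hu.comp (continuous_const.prodMk continuous_snd)) hu

theorem integrable_designerIndirect (hu : Continuous fun p : A × State => u p.1 p.2 θ)
    (hv : Continuous fun p : A × State => v p.1 p.2 θ) (P : Measure State) [IsFiniteMeasure P] :
    Integrable (fun m => designerIndirect u v m θ) P := by
  obtain ⟨C, hC⟩ := isCompact_univ.exists_bound_of_continuousOn hv.continuousOn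
  refine Integrable.of_bound
    (upperSemicontinuous_designerIndirect hu hv).measurable.aestronglyMeasurable C
    (Filter.Eventually.of_forall fun m => ?_)
  obtain ⟨a, -, ha⟩ := exists_eq_designerIndirect hu hv m
  exact ha ▸ hC (a, m) trivial

end IndirectUtility

section Payoffs

variable {F : Measure State} [IsProbabilityMeasure F] {A : Type w} [TopologicalSpace A] {n : ℕ}
  {u v : A → State → Fin n → ℝ}

theorem Signal.condExpUtility_eq {U : A → State → Fin n → ℝ} (hU : QuasiLinear U)
    (μ : Signal.{u}) (s : μ.S) (b : A) (θ : Fin n) :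
    μ.condExpUtility F U s b θ = U b (μ.posteriorMean F s) θ := by
  obtain ⟨U₁, U₂, -, -, hU⟩ := hU
  simp only [Signal.condExpUtility, hU]
  rw [integral_add (integrable_of_continuous _ (by fun_prop)) (integrable_const _),
    integral_const_mul]
  simp [Signal.posteriorMean]

theorem Signal.integral_integral_posteriorMean (μ : Signal.{u}) {φ : State → ℝ}
    (hφ : Measurable φ) (hφ_int : Integrable φ (μ.meanLaw F : Measure State)) :
    ∫ ω, ∫ s, φ (μ.posteriorMean F s) ∂(μ.kernel ω) ∂F =
      ∫ m, φ m ∂(μ.meanLaw F : Measure State) := by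
  rw [μ.integral_meanLaw hφ]
  exact (integral_bind_kernel (hφ_int.comp_measurable (μ.measurable_posteriorMean F))).symm

variable [CompactSpace A]

theorem Signal.receiverValue_eq (hu : QuasiLinear u) (ν : Signal.{u}) (θ : Fin n) :
    ν.receiverValue F u θ = ∫ m, receiverIndirect u m θ ∂(ν.meanLaw F : Measure State) := by
  have hc := continuous_receiverIndirect (hu.continuous θ)
  simp only [Signal.receiverValue, Signal.condExpUtility_eq hu]
  exact ν.integral_integral_posteriorMean hc.measurable (integrable_of_continuous _ hc)

theorem Strategy.IsOptimal.incentiveCompatible (hu : QuasiLinear u) {M : Set Signal.{u}}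
    {σ : Strategy.{u} A n} (hσ : σ.IsOptimal F u M) : IncentiveCompatible F u σ.signal := by
  intro θ θ'
  simpa only [Signal.receiverValue_eq hu] using hσ.optSignal θ _ (hσ.mem θ')

variable [Nonempty A]

theorem Strategy.IsOptimal.designerPayoff_le {g : Fin n → ℝ} (hg : ∀ θ, 0 ≤ g θ)
    (hu : QuasiLinear u) (hv : QuasiLinear v) {M : Set Signal.{u}} {σ : Strategy.{u} A n}
    (hσ : σ.IsOptimal F u M) (hσ_payoff : σ.HasPayoff F v) :
    σ.designerPayoff F g v ≤ programObjective g u v fun θ => (σ.signal θ).meanLaw F := by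
  refine Finset.sum_le_sum fun θ _ => mul_le_mul_of_nonneg_left ?_ (hg θ)
  have hsemi := upperSemicontinuous_designerIndirect (hu.continuous θ) (hv.continuous θ)
  rw [(σ.signal θ).integral_meanLaw hsemi.measurable]
  refine (integral_bind_kernel (hσ_payoff θ)).symm.trans_le (integral_mono_ae (hσ_payoff θ)
    ((integrable_designerIndirect (hu.continuous θ) (hv.continuous θ) _).comp_measurable
      ((σ.signal θ).measurable_posteriorMean F)) ?_)
  filter_upwards [hσ.optAct θ] with s hs
  simp only [Signal.condExpUtility_eq hu] at hs
  rw [Signal.condExpUtility_eq hv]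
  exact le_designerIndirect (hv.continuous θ) hs

/- The receiver breaks ties in favour of the designer. -/
theorem IncentiveCompatible.exists_action (g : Fin n → ℝ) (hu : QuasiLinear u)
    (hv : QuasiLinear v) {μ : Fin n → Signal.{u}} (hμ : IncentiveCompatible F u μ) :
    ∃ a : (θ : Fin n) → (μ θ).S → A,
      (Strategy.mk μ a).IsOptimal F u (Set.range μ) ∧ (Strategy.mk μ a).HasPayoff F v ∧
      (Strategy.mk μ a).designerPayoff F g v =
        programObjective g u v fun θ => (μ θ).meanLaw F := by
  choose a ha hav using fun θ m =>
    exists_eq_designerIndirect (hu.continuous θ) (hv.continuous θ) m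
  have hint (θ : Fin n) (P : Measure State) [IsFiniteMeasure P] :=
    integrable_designerIndirect (hu.continuous θ) (hv.continuous θ) P
  refine ⟨fun θ s => a θ ((μ θ).posteriorMean F s), ⟨fun θ => ⟨θ, rfl⟩, ?_, ?_⟩, ?_, ?_⟩
  · refine fun θ => Filter.Eventually.of_forall fun s b => ?_
    simp only [Signal.condExpUtility_eq hu]
    exact ha θ _ b
  · rintro θ _ ⟨θ', rfl⟩
    simp only [Signal.receiverValue_eq hu]
    exact hμ θ θ'
  · intro θ
    simp only [Signal.condExpUtility_eq hv, hav]
    exact (hint θ _).comp_measurable ((μ θ).measurable_posteriorMean F)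
  · refine Finset.sum_congr rfl fun θ _ => ?_
    simp only [Signal.condExpUtility_eq hv, hav]
    rw [(μ θ).integral_integral_posteriorMean
      (upperSemicontinuous_designerIndirect (hu.continuous θ) (hv.continuous θ)).measurable
      (hint θ _)]

end Payoffs

section MomentProblem

theorem exists_nonneg_extension {P E : Type*} [AddCommGroup P] [Module ℝ P] [AddCommGroup E]
    [Module ℝ E] (T : P →ₗ[ℝ] E) (l : P →ₗ[ℝ] ℝ) (s : PointedCone ℝ E)
    (hpos : ∀ p, T p ∈ s → 0 ≤ l p) (hdense : ∀ y, ∃ p, T p + y ∈ s) :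
    ∃ L : E →ₗ[ℝ] ℝ, (∀ p, L (T p) = l p) ∧ ∀ x ∈ s, 0 ≤ L x := by
  have hker : l ∈ (LinearMap.ker T).dualAnnihilator := by
    refine (Submodule.mem_dualAnnihilator _).2 fun p hp => le_antisymm ?_ ?_
    · simpa using hpos (-p) (by simp [LinearMap.mem_ker.1 hp])
    · exact hpos p (by simp [LinearMap.mem_ker.1 hp])
  rw [← LinearMap.range_dualMap_eq_dualAnnihilator_ker] at hker
  obtain ⟨f, rfl⟩ := hker
  obtain ⟨L, hL, hLs⟩ := riesz_extension s (f.toPMap (LinearMap.range T))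
    (by rintro ⟨_, p, rfl⟩ hp; exact hpos p hp)
    (fun y => (hdense y).imp' (fun p => ⟨T p, p, rfl⟩) fun _ hp => hp)
  exact ⟨L, fun p => hL ⟨T p, p, rfl⟩, hLs⟩

theorem exists_measure_of_nonneg {X : Type*} [TopologicalSpace X] [CompactSpace X] [T2Space X]
    [MeasurableSpace X] [BorelSpace X] (L : C(X, ℝ) →ₗ[ℝ] ℝ) (hL : ∀ φ, 0 ≤ φ → 0 ≤ L φ) :
    ∃ π : Measure X, IsFiniteMeasure π ∧ ∀ φ : C(X, ℝ), ∫ x, φ x ∂π = L φ := by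
  let Λ : CompactlySupportedContinuousMap X ℝ →ₚ[ℝ] ℝ := PositiveLinearMap.mk₀
    { toFun := fun φ => L φ.toContinuousMap
      map_add' := fun φ ψ => L.map_add φ.toContinuousMap ψ.toContinuousMap
      map_smul' := fun r φ => L.map_smul r φ.toContinuousMap }
    (fun φ hφ => hL _ hφ)
  exact ⟨RealRMK.rieszMeasure Λ, inferInstance, fun φ => RealRMK.integral_rieszMeasure Λ
    (CompactlySupportedContinuousMap.continuousMapEquiv φ)⟩

theorem exists_measure_integral_eq {X : Type*} [TopologicalSpace X] [CompactSpace X] [T2Space X]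
    [MeasurableSpace X] [BorelSpace X] {P : Type*} [AddCommGroup P] [Module ℝ P]
    (T : P →ₗ[ℝ] C(X, ℝ)) (l : P →ₗ[ℝ] ℝ) (hpos : ∀ p, 0 ≤ T p → 0 ≤ l p)
    {e : P} (he : T e = 1) :
    ∃ π : Measure X, IsFiniteMeasure π ∧ ∀ p, ∫ x, T p x ∂π = l p := by
  obtain ⟨L, hLT, hL⟩ := exists_nonneg_extension T l (PointedCone.positive ℝ C(X, ℝ)) hpos
    fun ψ => ⟨‖ψ‖ • e, fun x => by
      simpa [he] using neg_le_iff_add_nonneg'.1 (neg_le_of_abs_le (ψ.norm_coe_le_norm x))⟩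
  obtain ⟨π, hπ, hπL⟩ := exists_measure_of_nonneg L hL
  exact ⟨π, hπ, fun p => (hπL (T p)).trans (hLT p)⟩

/-- Integration against `P` as a linear functional on continuous functions. -/
noncomputable def integralFunctional {X : Type*} [TopologicalSpace X] [CompactSpace X]
    [MeasurableSpace X] [OpensMeasurableSpace X] (P : Measure X) [IsFiniteMeasure P] :
    C(X, ℝ) →ₗ[ℝ] ℝ where
  toFun φ := ∫ x, φ x ∂P
  map_add' φ ψ := integral_add (integrable_of_continuous P φ.continuous)
    (integrable_of_continuous P ψ.continuous)
  map_smul' r φ := integral_const_mul r φ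

end MomentProblem

section MartingaleCoupling

theorem setIntegral_preimage_eq_of_forall_integral_mul_eq {α X : Type*} [MeasurableSpace α]
    [TopologicalSpace X] [HasOuterApproxClosed X] [MeasurableSpace X] [BorelSpace X]
    {π : Measure α} {f g : α → ℝ} (hf : Integrable f π) (hg : Integrable g π) (hf_nonneg : 0 ≤ f)
    (hg_nonneg : 0 ≤ g) {T : α → X} (hT : Measurable T)
    (h : ∀ φ : BoundedContinuousFunction X ℝ,
      ∫ a, φ (T a) * f a ∂π = ∫ a, φ (T a) * g a ∂π)
    {B : Set X} (hB : MeasurableSet B) :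
    ∫ a in T ⁻¹' B, f a ∂π = ∫ a in T ⁻¹' B, g a ∂π := by
  let law (f : α → ℝ) : Measure X := (π.withDensity fun a => ENNReal.ofReal (f a)).map T
  have hlaw_finite {f : α → ℝ} (hf : Integrable f π) : IsFiniteMeasure (law f) :=
    have := isFiniteMeasure_withDensity_ofReal hf.2
    Measure.isFiniteMeasure_map _ T
  have hlaw_integral {f : α → ℝ} (hf : Integrable f π) (hf_nonneg : 0 ≤ f)
      (φ : BoundedContinuousFunction X ℝ) : ∫ x, φ x ∂(law f) = ∫ a, φ (T a) * f a ∂π := by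
    rw [integral_map hT.aemeasurable φ.continuous.aestronglyMeasurable,
      integral_withDensity_eq_integral_toReal_smul₀ hf.aemeasurable.ennreal_ofReal (by simp)]
    simp only [ENNReal.toReal_ofReal (hf_nonneg _), smul_eq_mul, mul_comm]
  have hlaw_apply {f : α → ℝ} (hf : Integrable f π) (hf_nonneg : 0 ≤ f) :
      ∫ a in T ⁻¹' B, f a ∂π = (law f).real B := by
    rw [map_measureReal_apply hT hB, measureReal_def, withDensity_apply _ (hT hB),
      integral_eq_lintegral_of_nonneg_ae (ae_of_all _ hf_nonneg) hf.1.restrict]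
  have := hlaw_finite hf
  have := hlaw_finite hg
  have hlaw : law f = law g := ext_of_forall_integral_eq_of_IsFiniteMeasure fun φ => by
    rw [hlaw_integral hf hf_nonneg, hlaw_integral hg hg_nonneg, h]
  rw [hlaw_apply hf hf_nonneg, hlaw_apply hg hg_nonneg, hlaw]

/-- A martingale coupling of `F` and `H`: a joint law of `(ω, m)` with marginals `F` and `H` under
which `m` is the conditional expectation of `ω` given `m`, the latter being expressed through
integrals over the events `m ∈ B`. -/
structure IsMartingaleCoupling (π : Measure (State × State)) (F H : Measure State) : Prop where
  fst_eq : π.fst = F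
  snd_eq : π.snd = H
  setIntegral_eq : ∀ B : Set State, MeasurableSet B →
    ∫ p in Prod.snd ⁻¹' B, (p.1 : ℝ) ∂π = ∫ p in Prod.snd ⁻¹' B, (p.2 : ℝ) ∂π

/-- The linear map taking `(φ, χ, h)` to the function `(ω, m) ↦ φ ω + χ m + h m * (ω - m)`. Its
values are the functions whose integral against a martingale coupling is fixed by the marginals. -/
def martingaleTest : C(State, ℝ) × C(State, ℝ) × C(State, ℝ) →ₗ[ℝ] C(State × State, ℝ) where
  toFun p := ⟨fun x => p.1 x.1 + p.2.1 x.2 + p.2.2 x.2 * ((x.1 : ℝ) - x.2), by fun_prop⟩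
  map_add' p q := by
    ext x
    simp only [Prod.fst_add, ContinuousMap.add_apply, Prod.snd_add, ContinuousMap.coe_mk]
    ring
  map_smul' r p := by
    ext x
    simp only [Prod.smul_fst, ContinuousMap.coe_smul, Pi.smul_apply, smul_eq_mul, Prod.smul_snd,
      ContinuousMap.coe_mk, RingHom.id_apply]
    ring

theorem isMartingaleCoupling_of_integral_martingaleTest {π : Measure (State × State)}
    [IsFiniteMeasure π] {F H : Measure State} [IsFiniteMeasure F] [IsFiniteMeasure H]
    (hπ : ∀ φ χ h : C(State, ℝ),
      ∫ p, martingaleTest (φ, χ, h) p ∂π = ∫ ω, φ ω ∂F + ∫ m, χ m ∂H) :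
    IsMartingaleCoupling π F H where
  fst_eq := by
    refine ext_of_forall_integral_eq_of_IsFiniteMeasure fun φ => ?_
    rw [Measure.fst, integral_map measurable_fst.aemeasurable φ.continuous.aestronglyMeasurable]
    simpa [martingaleTest] using hπ φ.toContinuousMap 0 0
  snd_eq := by
    refine ext_of_forall_integral_eq_of_IsFiniteMeasure fun χ => ?_
    rw [Measure.snd, integral_map measurable_snd.aemeasurable χ.continuous.aestronglyMeasurable]
    simpa [martingaleTest] using hπ 0 χ.toContinuousMap 0
  setIntegral_eq B hB := by
    refine setIntegral_preimage_eq_of_forall_integral_mul_eq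
      (integrable_of_continuous π (by fun_prop)) (integrable_of_continuous π (by fun_prop))
      (fun p => p.1.2.1) (fun p => p.2.2.1) measurable_snd (fun h => ?_) hB
    rw [← sub_eq_zero, ← integral_sub (integrable_of_continuous π (by fun_prop))
      (integrable_of_continuous π (by fun_prop))]
    simpa [martingaleTest, mul_sub] using hπ 0 0 h.toContinuousMap

variable {F H : Measure State} [IsProbabilityMeasure F] [IsProbabilityMeasure H]

/- The concave function `c y = ⨅ m, χ m + h m * (y - m)` separates `-φ` from `χ`. -/
theorem IsMPC.integral_add_integral_nonneg (hFH : IsMPC F H) (φ χ h : C(State, ℝ))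
    (hpos : ∀ ω m : State, 0 ≤ φ ω + χ m + h m * ((ω : ℝ) - m)) :
    0 ≤ ∫ ω, φ ω ∂F + ∫ m, χ m ∂H := by
  let line : State → ℝ → ℝ := fun m y => χ m + h m * (y - m)
  let c : ℝ → ℝ := fun y => ⨅ m, line m y
  have hbdd (y : ℝ) : BddBelow (Set.range fun m => line m y) :=
    (isCompact_range (by fun_prop)).bddBelow
  have hline_lip (m : State) : LipschitzWith ‖h‖₊ (line m) := by
    refine LipschitzWith.of_dist_le_mul fun y z => ?_
    rw [Real.dist_eq, show line m y - line m z = h m * (y - z) by simp only [line]; ring, abs_mul,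
      Real.dist_eq]
    exact mul_le_mul_of_nonneg_right (h.norm_coe_le_norm m) (abs_nonneg _)
  have hline_concave (m : State) : ConcaveOn ℝ (Set.Icc 0 1) (line m) := by
    refine ⟨convex_Icc 0 1, fun y _ z _ a b _ _ hab => le_of_eq ?_⟩
    obtain rfl : b = 1 - a := by linarith
    simp only [line, smul_eq_mul]
    ring
  have hc : ConcaveOn ℝ (Set.Icc 0 1) c := concaveOn_ciInf hline_concave fun y _ => hbdd y
  have hc_lip : LipschitzWith ‖h‖₊ c := lipschitzWith_ciInf hline_lip hbdd
  have hc_int (P : Measure State) [IsProbabilityMeasure P] :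
      Integrable (fun ω : State => c ω) P :=
    integrable_of_continuous P (hc_lip.continuous.comp continuous_subtype_val)
  rw [← neg_le_iff_add_nonneg', ← integral_neg]
  calc ∫ ω, -φ ω ∂F ≤ ∫ ω : State, c ω ∂F :=
        integral_mono (integrable_of_continuous F (by fun_prop)) (hc_int F) fun ω =>
          le_ciInf fun m => by linarith [hpos ω m]
    _ ≤ ∫ m : State, c m ∂H := hFH.integral_concaveOn_le hc hc_lip.lipschitzOnWith
    _ ≤ ∫ m, χ m ∂H :=
        integral_mono (hc_int H) (integrable_of_continuous H χ.continuous) fun m =>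
          (ciInf_le (hbdd m) m).trans_eq (by simp [line])

/- Strassen's theorem: by duality, the obstruction to a coupling would be a test function violating
`IsMPC.integral_add_integral_nonneg`. -/
theorem IsMPC.exists_isMartingaleCoupling (hFH : IsMPC F H) :
    ∃ π : Measure (State × State), IsProbabilityMeasure π ∧ IsMartingaleCoupling π F H := by
  obtain ⟨π, _, hπ⟩ := exists_measure_integral_eq martingaleTest
    ((integralFunctional F).coprod ((integralFunctional H).coprod 0))
    (fun ⟨φ, χ, h⟩ hp => by
      simpa [integralFunctional] using
        hFH.integral_add_integral_nonneg φ χ h fun ω m => hp (ω, m))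
    (e := (1, 0, 0)) (by ext; simp [martingaleTest])
  have hcoupling : IsMartingaleCoupling π F H :=
    isMartingaleCoupling_of_integral_martingaleTest fun φ χ h => by
      simpa [integralFunctional] using hπ (φ, χ, h)
  exact ⟨π, ⟨by rw [← Measure.fst_univ, hcoupling.fst_eq, measure_univ]⟩, hcoupling⟩

end MartingaleCoupling

section Realization

variable {F : Measure State} [IsProbabilityMeasure F]

theorem Signal.setIntegral_posteriorMean (μ : Signal.{u}) {B : Set μ.S} (hB : MeasurableSet B) :
    ∫ s in B, (μ.posteriorMean F s : ℝ) ∂(μ.messageLaw F) =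
      ∫ p in Prod.snd ⁻¹' B, (p.1 : ℝ) ∂(F ⊗ₘ μ.kernel) := by
  have hjoint : (F ⊗ₘ μ.kernel).map Prod.swap = (μ.messageLaw F) ⊗ₘ (μ.posterior F) :=
    compProd_posterior_eq_map_swap.symm
  have hint : Integrable (fun p : μ.S × State => (p.2 : ℝ))
      ((μ.messageLaw F) ⊗ₘ (μ.posterior F)) :=
    Integrable.of_bound (by fun_prop) 1 (ae_of_all _ fun p => by
      simpa only [Real.norm_eq_abs, abs_of_nonneg p.2.2.1] using p.2.2.2)
  calc ∫ s in B, (μ.posteriorMean F s : ℝ) ∂(μ.messageLaw F)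
    _ = ∫ p in B ×ˢ Set.univ, (p.2 : ℝ) ∂((μ.messageLaw F) ⊗ₘ (μ.posterior F)) := by
      rw [Measure.setIntegral_compProd hB MeasurableSet.univ hint.integrableOn]
      simp [Signal.posteriorMean]
    _ = ∫ p in Prod.snd ⁻¹' B, (p.1 : ℝ) ∂(F ⊗ₘ μ.kernel) := by
      rw [← hjoint, setIntegral_map (hB.prod MeasurableSet.univ) (by fun_prop)
        measurable_swap.aemeasurable]
      congr 2
      ext p
      simp

theorem Signal.posteriorMean_ae_eq (μ : Signal.{u}) {T : μ.S → State} (hT : Measurable T)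
    (h : ∀ B, MeasurableSet B → ∫ p in Prod.snd ⁻¹' B, (p.1 : ℝ) ∂(F ⊗ₘ μ.kernel) =
      ∫ s in B, (T s : ℝ) ∂(μ.messageLaw F)) :
    μ.posteriorMean F =ᵐ[μ.messageLaw F] T := by
  have hint {T : μ.S → State} (hT : Measurable T) :
      Integrable (fun s => (T s : ℝ)) (μ.messageLaw F) :=
    (integrable_of_continuous ((μ.messageLaw F).map T) continuous_subtype_val).comp_measurable hT
  have hae := Integrable.ae_eq_of_forall_setIntegral_eq _ _ (hint (μ.measurable_posteriorMean F))
    (hint hT) fun B hB _ => (μ.setIntegral_posteriorMean hB).trans (h B hB)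
  filter_upwards [hae] with s hs
  exact Subtype.ext hs

/- The message is the second coordinate of the coupling, drawn from its conditional law given the
first; `ULift` moves it to the universe of messages. -/
theorem IsMartingaleCoupling.exists_signal {π : Measure (State × State)} [IsFiniteMeasure π]
    {H : Measure State} (hπ : IsMartingaleCoupling π F H) :
    ∃ μ : Signal.{u}, (μ.meanLaw F : Measure State) = H := by
  have hup : Measurable (ULift.up : State → ULift.{u} State) := measurable_up
  have := Kernel.IsMarkovKernel.map π.condKernel hup
  let μ : Signal.{u} := ⟨ULift.{u} State, π.condKernel.map ULift.up⟩
  let down : μ.S → State := ULift.down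
  have hdown : Measurable down := measurable_down
  have hdown_real : Measurable fun s => (down s : ℝ) := measurable_subtype_coe.comp hdown
  have hjoint : F ⊗ₘ μ.kernel = π.map (Prod.map id ULift.up) := by
    rw [← hπ.fst_eq, Measure.compProd_map hup, π.disintegrate π.condKernel]
  have hlaw : μ.messageLaw F = H.map ULift.up := by
    rw [Signal.messageLaw, ← Measure.snd_compProd, hjoint, ← hπ.snd_eq, Measure.snd, Measure.snd,
      Measure.map_map measurable_snd (measurable_id.prodMap hup),
      Measure.map_map hup measurable_snd]
    rfl
  have hmean : μ.posteriorMean F =ᵐ[μ.messageLaw F] down := by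
    refine μ.posteriorMean_ae_eq hdown fun B hB => ?_
    calc ∫ p in Prod.snd ⁻¹' B, (p.1 : ℝ) ∂(F ⊗ₘ μ.kernel)
      _ = ∫ p in Prod.snd ⁻¹' (ULift.up ⁻¹' B), (p.1 : ℝ) ∂π := by
        rw [hjoint, setIntegral_map (measurable_snd hB) (by fun_prop) (by fun_prop)]
        rfl
      _ = ∫ p in Prod.snd ⁻¹' (ULift.up ⁻¹' B), (p.2 : ℝ) ∂π := hπ.setIntegral_eq _ (hup hB)
      _ = ∫ s in B, (down s : ℝ) ∂(μ.messageLaw F) := by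
        rw [hlaw, setIntegral_map hB hdown_real.aestronglyMeasurable hup.aemeasurable,
          ← hπ.snd_eq, Measure.snd, setIntegral_map (hup hB) (by fun_prop)
          measurable_snd.aemeasurable]
  refine ⟨μ, ?_⟩
  change (μ.messageLaw F).map (μ.posteriorMean F) = H
  rw [Measure.map_congr hmean, hlaw, Measure.map_map hdown hup]
  exact Measure.map_id

theorem IsMPC.exists_signal {H : ProbabilityMeasure State} (hFH : IsMPC F (H : Measure State)) :
    ∃ μ : Signal.{u}, μ.meanLaw F = H := by
  obtain ⟨π, _, hπ⟩ := hFH.exists_isMartingaleCoupling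
  obtain ⟨μ, hμ⟩ := hπ.exists_signal
  exact ⟨μ, Subtype.ext hμ⟩

end Realization

section Revelation

variable {F : Measure State} [IsProbabilityMeasure F] {A : Type w} {n : ℕ}
  {u : A → State → Fin n → ℝ}

theorem Strategy.IsOptimal.programFeasible [TopologicalSpace A] [CompactSpace A]
    (hu : QuasiLinear u) {M : Set Signal.{u}} {σ : Strategy.{u} A n} (hσ : σ.IsOptimal F u M) :
    ProgramFeasible F u fun θ => (σ.signal θ).meanLaw F :=
  ⟨hσ.incentiveCompatible hu, fun θ => (σ.signal θ).isMPC_meanLaw⟩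

theorem ProgramFeasible.exists_incentiveCompatible {H : Fin n → ProbabilityMeasure State}
    (hH : ProgramFeasible F u H) :
    ∃ ν : Fin n → Signal.{u}, IncentiveCompatible F u ν ∧ (fun θ => (ν θ).meanLaw F) = H := by
  choose ν hν using fun θ => (hH.mpc θ).exists_signal
  obtain rfl := funext hν
  exact ⟨ν, hH.ic, rfl⟩

end Revelation

end InfoDesign

open InfoDesign in
theorem proposition1_general {A : Type w} [TopologicalSpace A] [CompactSpace A] [Nonempty A]
    {n : ℕ} (F : Measure State) [IsProbabilityMeasure F] (g : Fin n → ℝ) (hg : ∀ θ, 0 ≤ g θ)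
    (u v : A → State → Fin n → ℝ) (hu : QuasiLinear u) (hv : QuasiLinear v)
    (μ : Fin n → Signal.{u}) :
    (IncentiveCompatible F u μ ∧ DesignerOptimal F g u v μ) ↔
      SolvesProgram F g u v (fun θ => (μ θ).meanLaw F) := by
  constructor
  · rintro ⟨-, a, ha, ha_payoff, ha_max⟩
    refine ⟨ha.programFeasible hu, fun H hH => ?_⟩
    obtain ⟨ν, hν, rfl⟩ := hH.exists_incentiveCompatible
    obtain ⟨b, hb, hb_payoff, hb_eq⟩ := hν.exists_action g hu hv
    calc programObjective g u v (fun θ => (ν θ).meanLaw F)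
      _ = (Strategy.mk ν b).designerPayoff F g v := hb_eq.symm
      _ ≤ (Strategy.mk μ a).designerPayoff F g v := ha_max _ _ hb hb_payoff
      _ ≤ programObjective g u v fun θ => (μ θ).meanLaw F := ha.designerPayoff_le hg hu hv ha_payoff
  · rintro ⟨hfeasible, hmax⟩
    obtain ⟨a, ha, ha_payoff, ha_eq⟩ :=
      IncentiveCompatible.exists_action g hu hv hfeasible.ic
    refine ⟨hfeasible.ic, a, ha, ha_payoff, fun M σ hσ hσ_payoff => ?_⟩
    calc σ.designerPayoff F g v
      _ ≤ programObjective g u v fun θ => (σ.signal θ).meanLaw F :=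
        hσ.designerPayoff_le hg hu hv hσ_payoff
      _ ≤ programObjective g u v fun θ => (μ θ).meanLaw F := hmax _ (hσ.programFeasible hu)
      _ = (Strategy.mk μ a).designerPayoff F g v := ha_eq.symm

theorem proposition1 {A : Type w} [TopologicalSpace A] [CompactSpace A] [Nonempty A] {n : ℕ}
    (f : InfoDesign.State → ENNReal) (hf : Measurable f)
    (F : MeasureTheory.Measure InfoDesign.State) [MeasureTheory.IsProbabilityMeasure F]
    (hF : F = MeasureTheory.volume.withDensity f)
    (g : Fin n → ℝ) (hg_pos : ∀ θ, 0 < g θ) (hg_sum : ∑ θ, g θ = 1)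
    (u v : A → InfoDesign.State → Fin n → ℝ)
    (hu : InfoDesign.QuasiLinear u) (hv : InfoDesign.QuasiLinear v)
    (μ : Fin n → InfoDesign.Signal.{u}) :
    (InfoDesign.IncentiveCompatible F u μ ∧ InfoDesign.DesignerOptimal F g u v μ) ↔
      InfoDesign.SolvesProgram F g u v (fun θ => (μ θ).meanLaw F) :=
  proposition1_general F g (fun θ => (hg_pos θ).le) u v hu hv μ
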